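/- For $k\in\mathbb Z$ let $P_k=[2^k-2^{k-1},2^k+2^{k-1}]$. Say that a family of Schwartz functions $\varphi_i$ on $\mathbb R$ is uniformly adapted in frequency to the intervals $P_{j(i)}$ if $\widehat{\varphi_i}$ is supported in $P_{j(i)}$ for every $i$ and, for every integer $m\ge 0$, there is a constant $A_m$ independent of $i$ with $|\partial^m\widehat{\varphi_i}(\xi)|\le A_m|P_{j(i)}|^{-m}$ for all $\xi\in\mathbb R$ and all $i$. For a function $\varphi$ on $\mathbb R$ write $\widetilde{\varphi}(x)=\varphi(-x)$. Then there exist complex-valued Schwartz functions $\{\eta^k\}_{k\in\mathbb Z}$ and $\{\eta^\lambda_k\}_{(k,\lambda)\in\mathbb Z^2}$ on $\mathbb R$, with $\eta^k$ uniformly adapted in frequency to $P_k$ and $\eta^\lambda_k$ uniformly (in $k$ and $\lambda$) adapted in frequency to $P_\lambda$, such that the bilinear operator $$\mathcal B(f_1,f_2)(x)=\sum_{k\in\mathbb Z}\sum_{\lambda\in\mathbb Z}\Big(\big[(f_1*\eta^k)\,(f_2*\widetilde{\eta^k})\big]*\eta^\lambda_k\Big)(x)$$ is well defined on $\mathcal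 S(\mathbb R)\times\mathcal S(\mathbb R)$, the double series converging absolutely at every $x\in\mathbb R$, and satisfies no $L^p$ estimates: for all $p_1,p_2\in[1,\infty]$, with $\frac1p=\frac1{p_1}+\frac1{p_2}$, there is no constant $C<\infty$ such that $$\|\mathcal B(f_1,f_2)\|_{L^p(\mathbb R)}\le C\,\|f_1\|_{L^{p_1}(\mathbb R)}\|f_2\|_{L^{p_2}(\mathbb R)}\qquad\text{for all } f_1,f_2\in\mathcal S(\mathbb R).$$ -/

import Mathlib

open MeasureTheory FourierTransform
open scoped SchwartzMap ENNReal NNReal Convolution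

noncomputable section

/-- The interval `P_j = [2^j - 2^(j-1), 2^j + 2^(j-1)]`, of length `2^j`, for `j ∈ ℤ`. -/
def lacInterval (j : ℤ) : Set ℝ :=
  Set.Icc ((2 : ℝ) ^ j - (2 : ℝ) ^ (j - 1)) ((2 : ℝ) ^ j + (2 : ℝ) ^ (j - 1))

/-- The Fourier transform of the Schwartz function `φ` is supported in `P_j` and adapted to `P_j`
with constants `A`: its `m`-th derivative is at most `A m * |P_j|^(-m)` for every `m ≥ 0`. -/
def FourierAdapted (A : ℕ → ℝ) (j : ℤ) (φ : 𝓢(ℝ, ℂ)) : Prop :=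
  Function.support (𝓕 (φ : ℝ → ℂ)) ⊆ lacInterval j ∧
    ∀ (m : ℕ) (ξ : ℝ), ‖iteratedDeriv m (𝓕 (φ : ℝ → ℂ)) ξ‖ ≤ A m / ((2 : ℝ) ^ j) ^ m

/-- Convolution of complex-valued functions on `ℝ`: `conv f g x = ∫ f y * g (x - y) dy`. -/
def conv (f g : ℝ → ℂ) : ℝ → ℂ :=
  f ⋆[ContinuousLinearMap.mul ℂ ℂ, volume] g

/-- The reflection `x ↦ φ (-x)`, whose Fourier transform is `ξ ↦ (𝓕 φ) (-ξ)`. -/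
def reflect (φ : ℝ → ℂ) : ℝ → ℂ := fun x => φ (-x)

/-- The `(k, l)` summand `[f₁ * η^k · f₂ * (η^k)~] * η_k^l` of the bilinear operator. -/
def bilinearTerm (η : ℤ → 𝓢(ℝ, ℂ)) (θ : ℤ → ℤ → 𝓢(ℝ, ℂ)) (f₁ f₂ : ℝ → ℂ) (k l : ℤ) : ℝ → ℂ :=
  conv (fun y => conv f₁ (η k) y * conv f₂ (reflect (η k)) y) (θ k l)

/-- The bilinear operator `∑_k ∑_l [f₁ * η^k · f₂ * (η^k)~] * η_k^l`, where `θ k l` is `η_k^l`. -/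
def bilinearOp (η : ℤ → 𝓢(ℝ, ℂ)) (θ : ℤ → ℤ → 𝓢(ℝ, ℂ)) (f₁ f₂ : ℝ → ℂ) : ℝ → ℂ :=
  fun x => ∑' k : ℤ, ∑' l : ℤ, bilinearTerm η θ f₁ f₂ k l x

/-- `T` satisfies the Hölder-type estimate `L^{p₁} × L^{p₂} → L^p`, where `1/p = 1/p₁ + 1/p₂`,
a priori on Schwartz functions. -/
def SatisfiesLpEstimate (T : (ℝ → ℂ) → (ℝ → ℂ) → ℝ → ℂ) (p₁ p₂ : ℝ≥0∞) : Prop :=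
  ∃ C : ℝ≥0, ∀ f₁ f₂ : 𝓢(ℝ, ℂ),
    eLpNorm (T f₁ f₂) (p₁⁻¹ + p₂⁻¹)⁻¹ volume
      ≤ C * eLpNorm f₁ p₁ volume * eLpNorm f₂ p₂ volume

end

/-! The operator is unbounded because of a choice of phases. The symbols of `scaleFamily` are real
bumps, while that of `phaseFamily k l` carries the constant exp(2πi 2^l k/n), where n = 2^L is the
largest power of two with n ≤ k. Since n is read off from k, one operator serves all L, and each
block n ≤ k < 2n can be tested separately.

For such a block let f = ∑_k exp(2πi 2^k x) w(x) F(x - k/n), with w a band-limited window and F a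
normalized Fejér kernel. The translates of F are nonnegative and sum to 1, so |f| ≤ |w|, and every
L^q norm of f is bounded uniformly in n (`norm_testFunction_le`). The k-th packet lives near
frequency 2^k, so the projections isolate it, and with f₂ the conjugate of f₁ = f the k-th product
is w² F(x - k/n)². Its component at frequency s turns with k like exp(-2πi s k/n). Summing over k
against the phase leaves only s ≡ 2^l mod n, and the l-th band keeps only s = 2^l
(`sum_convS_packet`). The output is w² ∑ c_l exp(2πi 2^l x) over 1 ≤ l ≤ L - 2
(`bilinearOp_testFunction`), with every c_l ≥ 1/64 (`one_div_le_quadCoeff`).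

A lacunary sum has L⁴ norm controlled by its L² norm, so this one has size at least a constant times
√(L - 2) on a set of measure at least 1/8 in (0, 1] (`one_eighth_le_measure_lacSum`), where w is
bounded below. Hence the output is unbounded in every L^p, including p < 1 and p = ∞. -/

noncomputable section

/-! ### Characters, and convolution and modulation of Schwartz functions. -/

/-- The character `t ↦ exp (2πit)`. -/
def expTwoPi (t : ℝ) : ℂ := Complex.exp (2 * Real.pi * t * Complex.I)

lemma expTwoPi_add (s t : ℝ) : expTwoPi (s + t) = expTwoPi s * expTwoPi t := by
  simp only [expTwoPi, ← Complex.exp_add]; congr 1; push_cast; ring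

@[simp] lemma norm_expTwoPi (t : ℝ) : ‖expTwoPi t‖ = 1 := by
  have : (2 * Real.pi * t * Complex.I : ℂ) = ((2 * Real.pi * t : ℝ) : ℂ) * Complex.I := by
    push_cast; ring
  rw [expTwoPi, this, Complex.norm_exp_ofReal_mul_I]

lemma expTwoPi_intCast (n : ℤ) : expTwoPi n = 1 := by
  rw [expTwoPi, Complex.exp_eq_one_iff]
  exact ⟨n, by push_cast; ring⟩

@[simp] lemma expTwoPi_zero : expTwoPi 0 = 1 := by simp [expTwoPi]

lemma conj_expTwoPi (t : ℝ) : (starRingEnd ℂ) (expTwoPi t) = expTwoPi (-t) := by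
  rw [expTwoPi, ← Complex.exp_conj, expTwoPi]
  congr 1
  simp [Complex.conj_ofNat]

lemma expTwoPi_eq_one_iff (t : ℝ) : expTwoPi t = 1 ↔ ∃ n : ℤ, t = n := by
  constructor
  · intro h
    rw [expTwoPi, Complex.exp_eq_one_iff] at h
    obtain ⟨n, hn⟩ := h
    refine ⟨n, ?_⟩
    have h2 : (2 * Real.pi * Complex.I : ℂ) ≠ 0 := by simp [Real.pi_ne_zero]
    have : (t : ℂ) = n := by
      apply mul_right_cancel₀ h2
      linear_combination hn
    exact_mod_cast this
  · rintro ⟨n, rfl⟩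
    exact expTwoPi_intCast n

lemma expTwoPi_pow (t : ℝ) (n : ℕ) : expTwoPi t ^ n = expTwoPi (n * t) := by
  rw [expTwoPi, expTwoPi, ← Complex.exp_nat_mul]; congr 1; push_cast; ring

@[fun_prop] lemma continuous_expTwoPi : Continuous expTwoPi := by
  unfold expTwoPi; fun_prop

namespace SchwartzMap

/-- Convolution of Schwartz functions on the line. -/
def convS (f g : 𝓢(ℝ, ℂ)) : 𝓢(ℝ, ℂ) := convolution (ContinuousLinearMap.mul ℂ ℂ) f g

/-- Product of Schwartz functions on the line. -/
def mulS (f g : 𝓢(ℝ, ℂ)) : 𝓢(ℝ, ℂ) := pairing (ContinuousLinearMap.mul ℂ ℂ) f g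

@[simp] lemma mulS_apply (f g : 𝓢(ℝ, ℂ)) (x : ℝ) : mulS f g x = f x * g x := rfl

lemma conv_coe (f g : 𝓢(ℝ, ℂ)) : conv f g = convS f g := by
  ext x
  exact (convolution_apply _ f g x).symm

lemma fourier_convS (f g : 𝓢(ℝ, ℂ)) : 𝓕 (convS f g) = mulS (𝓕 f) (𝓕 g) :=
  fourier_convolution _ f g

lemma fourier_mulS_neg (f g : 𝓢(ℝ, ℂ)) :
    𝓕⁻ (mulS (𝓕 f) (𝓕 g)) = convS f g := by
  rw [← fourier_convS, fourierInv_fourier_eq]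

lemma convS_sum_left {ι : Type*} (s : Finset ι) (f : ι → 𝓢(ℝ, ℂ)) (g : 𝓢(ℝ, ℂ)) :
    convS (∑ i ∈ s, f i) g = ∑ i ∈ s, convS (f i) g := by
  simp [convS, map_sum]

lemma convS_smul_left (c : ℂ) (f g : 𝓢(ℝ, ℂ)) : convS (c • f) g = c • convS f g := by
  simp [convS]

lemma convS_smul_right (c : ℂ) (f g : 𝓢(ℝ, ℂ)) : convS f (c • g) = c • convS f g := by
  simp [convS]

/-- Complex conjugation of Schwartz functions. -/
def conjS (f : 𝓢(ℝ, ℂ)) : 𝓢(ℝ, ℂ) :=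
  f.postcompCLM (𝕜 := ℝ) (Complex.conjCLE : ℂ →L[ℝ] ℂ)

@[simp] lemma conjS_apply (f : 𝓢(ℝ, ℂ)) (x : ℝ) : conjS f x = (starRingEnd ℂ) (f x) := rfl

lemma conjS_conjS (f : 𝓢(ℝ, ℂ)) : conjS (conjS f) = f := by
  ext x; simp

lemma conjS_convS (f g : 𝓢(ℝ, ℂ)) : conjS (convS f g) = convS (conjS f) (conjS g) := by
  ext x
  rw [conjS_apply, ← conv_coe, ← conv_coe]
  simp only [conv, convolution_def, ContinuousLinearMap.mul_apply']
  rw [← integral_conj]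
  simp

lemma norm_convS_le_fourier (f g : 𝓢(ℝ, ℂ)) (x : ℝ) :
    ‖convS f g x‖ ≤ ∫ ξ, ‖𝓕 f ξ‖ * ‖𝓕 g ξ‖ := by
  rw [← fourier_mulS_neg, fourierInv_coe, Real.fourierInv_eq]
  refine (norm_integral_le_integral_norm _).trans (le_of_eq ?_)
  simp only [Circle.norm_smul, mulS_apply, norm_mul]

lemma norm_convS_le (f g : 𝓢(ℝ, ℂ)) (C : ℝ) (hC : ∀ y, ‖f y‖ ≤ C) (x : ℝ) :
    ‖convS f g x‖ ≤ C * ∫ y, ‖g y‖ := by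
  rw [← conv_coe]
  simp only [conv, convolution_def, ContinuousLinearMap.mul_apply']
  have h1 : ∫ y, ‖g y‖ = ∫ y, ‖g (x - y)‖ :=
    (integral_sub_left_eq_self (fun y => ‖g y‖) volume x).symm
  rw [h1, ← integral_const_mul]
  refine norm_integral_le_of_norm_le ?_ (.of_forall fun y => ?_)
  · exact ((g.integrable.norm).comp_sub_left x).const_mul C
  · rw [norm_mul]
    gcongr
    exact hC y

/-- Modulation `x ↦ exp (2πibx) f x` of a Schwartz function. -/
def modS (b : ℝ) (f : 𝓢(ℝ, ℂ)) : 𝓢(ℝ, ℂ) := 𝓕⁻ (compSubConstCLM ℂ b (𝓕 f))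

lemma fourier_modS (b : ℝ) (f : 𝓢(ℝ, ℂ)) (ξ : ℝ) : 𝓕 (modS b f) ξ = 𝓕 f (ξ - b) := by
  rw [modS, fourier_fourierInv_eq, compSubConstCLM_apply]

lemma fourierInv_apply_eq_integral (f : 𝓢(ℝ, ℂ)) (x : ℝ) :
    𝓕⁻ f x = ∫ ξ, expTwoPi (ξ * x) * f ξ := by
  rw [fourierInv_coe, Real.fourierInv_eq']
  congr 1; ext ξ
  rw [expTwoPi, smul_eq_mul]
  congr 2
  simp [mul_comm]

lemma fourier_apply_eq_integral (f : 𝓢(ℝ, ℂ)) (x : ℝ) :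
    𝓕 f x = ∫ ξ, expTwoPi (-(ξ * x)) * f ξ := by
  rw [fourier_coe, Real.fourier_eq']
  congr 1; ext ξ
  rw [expTwoPi, smul_eq_mul]
  congr 2
  simp [mul_comm]

lemma fourier_apply_neg (f : 𝓢(ℝ, ℂ)) (x : ℝ) : 𝓕 f (-x) = 𝓕⁻ f x := by
  simp [fourier_apply_eq_integral, fourierInv_apply_eq_integral]

lemma modS_apply (b : ℝ) (f : 𝓢(ℝ, ℂ)) (x : ℝ) : modS b f x = expTwoPi (b * x) * f x := by
  have h : f x = 𝓕⁻ (𝓕 f) x := by rw [fourierInv_fourier_eq]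
  rw [h, modS, fourierInv_apply_eq_integral, fourierInv_apply_eq_integral, ← integral_const_mul,
    ← integral_sub_right_eq_self (fun ξ => expTwoPi (b * x) * (expTwoPi (ξ * x) * 𝓕 f ξ)) b]
  congr 1; ext ξ
  rw [compSubConstCLM_apply, ← mul_assoc, ← expTwoPi_add]
  congr 2; ring

lemma fourier_injective {f g : 𝓢(ℝ, ℂ)} (h : ∀ ξ, 𝓕 f ξ = 𝓕 g ξ) : f = g := by
  have : 𝓕 f = 𝓕 g := by ext ξ; exact h ξ
  rw [← fourierInv_fourier_eq (F := 𝓢(ℝ, ℂ)) f, this, fourierInv_fourier_eq]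

/-- Every frequency selection below is an instance of this, with c = 1 (the wave is kept) or c = 0
(it is killed). -/
lemma convS_modS (b : ℝ) (f g : 𝓢(ℝ, ℂ)) (c : ℂ)
    (h : ∀ ξ, 𝓕 f ξ ≠ 0 → 𝓕 g (b + ξ) = c) : convS (modS b f) g = c • modS b f := by
  apply fourier_injective
  intro ξ
  rw [fourier_convS, mulS_apply, FourierTransform.fourier_smul, smul_apply, fourier_modS,
    smul_eq_mul]
  by_cases h0 : 𝓕 f (ξ - b) = 0
  · simp [h0]
  · rw [← h _ h0, mul_comm]
    congr 2; ring

end SchwartzMap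

/-! ### Dyadic band-pass functions. -/

/-- A smooth bump equal to `1` on `[7/8, 9/8]` and supported in `(3/4, 5/4)`. -/
def bandBump : ContDiffBump (1 : ℝ) := ⟨1 / 8, 1 / 4, by norm_num, by norm_num⟩

/-- A smooth bump on the line as a complex-valued Schwartz function. -/
def ContDiffBump.toSchwartz {c : ℝ} (χ : ContDiffBump c) : 𝓢(ℝ, ℂ) :=
  HasCompactSupport.toSchwartzMap (f := fun ξ => (χ ξ : ℂ))
    (χ.hasCompactSupport.comp_left (g := Complex.ofReal) rfl)
    (Complex.ofRealCLM.contDiff.comp χ.contDiff)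

@[simp] lemma ContDiffBump.toSchwartz_apply {c : ℝ} (χ : ContDiffBump c) (ξ : ℝ) :
    χ.toSchwartz ξ = (χ ξ : ℂ) := rfl

/-- The bump `bandBump` rescaled to the interval `P_l`. -/
def bandSymbol (l : ℤ) : 𝓢(ℝ, ℂ) :=
  SchwartzMap.compCLMOfContinuousLinearEquiv ℂ
    (ContinuousLinearEquiv.unitsEquivAut ℝ (Units.mk0 (((2 : ℝ) ^ l)⁻¹) (by positivity)))
    bandBump.toSchwartz

lemma bandSymbol_apply (l : ℤ) (ξ : ℝ) :
    bandSymbol l ξ = (bandBump (ξ * ((2 : ℝ) ^ l)⁻¹) : ℂ) := rfl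

/-- The function with Fourier transform `c • bandSymbol l`. -/
def bandpass (c : ℂ) (l : ℤ) : 𝓢(ℝ, ℂ) := 𝓕⁻ (c • bandSymbol l)

lemma fourier_bandpass (c : ℂ) (l : ℤ) : 𝓕 (bandpass c l) = c • bandSymbol l :=
  fourier_fourierInv_eq _

lemma bandpass_eq_smul (c : ℂ) (l : ℤ) : bandpass c l = c • bandpass 1 l := by
  simp [bandpass, FourierTransform.fourierInv_smul]

@[simp] lemma bandpass_zero (l : ℤ) : bandpass 0 l = 0 := by
  rw [bandpass_eq_smul]; simp

lemma bandSymbol_eq_zero_of_le (l : ℤ) {ξ : ℝ} (h : ξ ≤ 3 / 4 * (2 : ℝ) ^ l) :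
    bandSymbol l ξ = 0 := by
  rw [bandSymbol_apply, bandBump.zero_of_le_dist]; · simp
  have h2 : (0 : ℝ) < 2 ^ l := by positivity
  have : ξ * ((2 : ℝ) ^ l)⁻¹ ≤ 3 / 4 := by
    rw [← div_eq_mul_inv, div_le_iff₀ h2]; exact h
  change (1 / 4 : ℝ) ≤ _
  rw [Real.dist_eq, abs_of_nonpos (by linarith)]
  linarith

lemma bandSymbol_eq_zero_of_ge (l : ℤ) {ξ : ℝ} (h : 5 / 4 * (2 : ℝ) ^ l ≤ ξ) :
    bandSymbol l ξ = 0 := by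
  rw [bandSymbol_apply, bandBump.zero_of_le_dist]; · simp
  have h2 : (0 : ℝ) < 2 ^ l := by positivity
  have : 5 / 4 ≤ ξ * ((2 : ℝ) ^ l)⁻¹ := by
    rw [← div_eq_mul_inv, le_div_iff₀ h2]; exact h
  change (1 / 4 : ℝ) ≤ _
  rw [Real.dist_eq, abs_of_nonneg (by linarith)]
  linarith

lemma bandSymbol_eq_one (l : ℤ) {ξ : ℝ} (h1 : 7 / 8 * (2 : ℝ) ^ l ≤ ξ)
    (h2 : ξ ≤ 9 / 8 * (2 : ℝ) ^ l) : bandSymbol l ξ = 1 := by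
  rw [bandSymbol_apply, bandBump.one_of_mem_closedBall]; · simp
  have h0 : (0 : ℝ) < 2 ^ l := by positivity
  have h3 : 7 / 8 ≤ ξ * ((2 : ℝ) ^ l)⁻¹ := by
    rw [← div_eq_mul_inv, le_div_iff₀ h0]; exact h1
  have h4 : ξ * ((2 : ℝ) ^ l)⁻¹ ≤ 9 / 8 := by
    rw [← div_eq_mul_inv, div_le_iff₀ h0]; exact h2
  rw [Metric.mem_closedBall, Real.dist_eq, abs_le]
  change -(1 / 8 : ℝ) ≤ _ ∧ _ ≤ (1 / 8 : ℝ)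
  constructor <;> linarith

lemma norm_bandSymbol_le_one (l : ℤ) (ξ : ℝ) : ‖bandSymbol l ξ‖ ≤ 1 := by
  rw [bandSymbol_apply, Complex.norm_real, Real.norm_of_nonneg bandBump.nonneg]
  exact bandBump.le_one

/-- The constants in the adaptedness of `bandpass c l` to `P_l`. -/
def bandConst (m : ℕ) : ℝ := SchwartzMap.seminorm ℝ 0 m bandBump.toSchwartz

lemma fourierAdapted_bandpass {c : ℂ} (hc : ‖c‖ ≤ 1) (l : ℤ) :
    FourierAdapted bandConst l (bandpass c l) := by
  have h0 : (0 : ℝ) < 2 ^ l := by positivity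
  have hF : 𝓕 (bandpass c l : ℝ → ℂ) =
      fun ξ => c * bandBump.toSchwartz (((2 : ℝ) ^ l)⁻¹ * ξ) := by
    rw [← SchwartzMap.fourier_coe, fourier_bandpass]
    ext ξ
    rw [smul_apply, smul_eq_mul, bandSymbol_apply, mul_comm ξ]
    rfl
  constructor
  · intro ξ hξ
    have hne : bandSymbol l ξ ≠ 0 := by
      rw [Function.mem_support, ← SchwartzMap.fourier_coe, fourier_bandpass] at hξ
      intro h
      exact hξ (by simp [h])
    have h1 : 3 / 4 * (2 : ℝ) ^ l < ξ := by
      by_contra! h; exact hne (bandSymbol_eq_zero_of_le l h)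
    have h2 : ξ < 5 / 4 * (2 : ℝ) ^ l := by
      by_contra! h; exact hne (bandSymbol_eq_zero_of_ge l h)
    rw [lacInterval, zpow_sub_one₀ two_ne_zero, Set.mem_Icc]
    constructor <;> linarith
  · intro m ξ
    have hs := congrFun (iteratedDeriv_comp_const_smul (n := m)
      (bandBump.toSchwartz.smooth m) (((2 : ℝ) ^ l)⁻¹)) ξ
    rw [hF, iteratedDeriv_const_mul_field, hs]
    have hb := SchwartzMap.le_seminorm' ℝ 0 m bandBump.toSchwartz (((2 : ℝ) ^ l)⁻¹ * ξ)
    rw [pow_zero, one_mul] at hb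
    rw [norm_mul, norm_smul, Real.norm_of_nonneg (by positivity), inv_pow, div_eq_inv_mul]
    calc ‖c‖ * _ ≤ 1 * _ := mul_le_mul_of_nonneg_right hc (by positivity)
      _ ≤ _ := by
        rw [one_mul]
        gcongr
        exact hb

lemma bandpass_one_apply (l : ℤ) (x : ℝ) :
    bandpass 1 l x = ((2 : ℝ) ^ l : ℝ) * 𝓕⁻ bandBump.toSchwartz ((2 : ℝ) ^ l * x) := by
  have h0 : (0 : ℝ) < 2 ^ l := by positivity
  rw [bandpass, one_smul, SchwartzMap.fourierInv_apply_eq_integral,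
    SchwartzMap.fourierInv_apply_eq_integral]
  have := Measure.integral_comp_mul_left
    (fun ξ => expTwoPi (ξ * ((2 : ℝ) ^ l * x)) * bandBump.toSchwartz ξ) (((2 : ℝ) ^ l)⁻¹)
  rw [inv_inv, abs_of_pos h0, Complex.real_smul] at this
  rw [← this]
  congr 1; ext ξ
  rw [bandSymbol_apply, mul_comm ξ (((2 : ℝ) ^ l)⁻¹), ContDiffBump.toSchwartz_apply]
  congr 2
  field_simp

/-- The common `L¹` norm of the functions `bandpass 1 l`. -/
def bandMass : ℝ := ∫ x, ‖𝓕⁻ bandBump.toSchwartz x‖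

lemma bandMass_nonneg : 0 ≤ bandMass := integral_nonneg fun _ => norm_nonneg _

lemma integral_norm_bandpass_le {c : ℂ} (hc : ‖c‖ ≤ 1) (l : ℤ) :
    ∫ x, ‖bandpass c l x‖ ≤ bandMass := by
  have h0 : (0 : ℝ) < 2 ^ l := by positivity
  have h1 : ∀ x, ‖bandpass c l x‖ =
      ‖c‖ * (2 : ℝ) ^ l * ‖𝓕⁻ bandBump.toSchwartz ((2 : ℝ) ^ l * x)‖ := by
    intro x
    rw [bandpass_eq_smul, smul_apply, bandpass_one_apply, smul_eq_mul, norm_mul,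
      norm_mul, Complex.norm_real, Real.norm_of_nonneg h0.le, mul_assoc]
  simp_rw [h1]
  rw [integral_const_mul, Measure.integral_comp_mul_left (fun x => ‖𝓕⁻ bandBump.toSchwartz x‖),
    abs_of_pos (inv_pos.2 h0), smul_eq_mul, mul_assoc, mul_inv_cancel_left₀ h0.ne']
  exact mul_le_of_le_one_left bandMass_nonneg hc

/-- The symbol is real, so conjugating the inverse Fourier integral only reverses the sign of x.
This is what turns the second factor of the operator into a conjugate of the first. -/
lemma reflect_bandpass {c : ℂ} (hc : (starRingEnd ℂ) c = c) (l : ℤ) :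
    reflect (bandpass c l) = SchwartzMap.conjS (bandpass c l) := by
  ext x
  rw [reflect, SchwartzMap.conjS_apply, bandpass, SchwartzMap.fourierInv_apply_eq_integral,
    SchwartzMap.fourierInv_apply_eq_integral, ← integral_conj]
  congr 1; ext ξ
  rw [map_mul, conj_expTwoPi, smul_apply, smul_eq_mul, map_mul, hc, bandSymbol_apply,
    Complex.conj_ofReal, mul_neg]

open SchwartzMap

/-! ### The two families and absolute convergence. -/

/-- The unimodular phase attached to the pair `(k, l)`, set to zero unless
`1 ≤ l ≤ log₂ k - 2`. -/
def blockPhase (k l : ℤ) : ℂ :=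
  if 1 ≤ l ∧ l + 2 ≤ (Nat.log 2 k.toNat : ℤ) then
    expTwoPi ((2 : ℝ) ^ l * k / 2 ^ Nat.log 2 k.toNat) else 0

/-- The band-pass family indexed by positive scales. -/
def scaleFamily (k : ℤ) : 𝓢(ℝ, ℂ) := bandpass (if 1 ≤ k then 1 else 0) k

/-- The band-pass family with phases. -/
def phaseFamily (k l : ℤ) : 𝓢(ℝ, ℂ) := bandpass (blockPhase k l) l

lemma norm_blockPhase_le (k l : ℤ) : ‖blockPhase k l‖ ≤ 1 := by
  unfold blockPhase; split_ifs <;> simp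

lemma fourierAdapted_scaleFamily (k : ℤ) : FourierAdapted bandConst k (scaleFamily k) :=
  fourierAdapted_bandpass (by split_ifs <;> simp) k

lemma fourierAdapted_phaseFamily (k l : ℤ) : FourierAdapted bandConst l (phaseFamily k l) :=
  fourierAdapted_bandpass (norm_blockPhase_le k l) l

lemma reflect_scaleFamily (k : ℤ) : reflect (scaleFamily k) = conjS (scaleFamily k) :=
  reflect_bandpass (by split_ifs <;> simp) k

lemma le_of_blockPhase_ne_zero {k l : ℤ} (h : blockPhase k l ≠ 0) : 1 ≤ l ∧ l ≤ k := by
  unfold blockPhase at h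
  split_ifs at h with h1
  · refine ⟨h1.1, ?_⟩
    have := Nat.log_le_self 2 k.toNat
    omega
  · exact absurd rfl h

lemma convS_zero_right (f : 𝓢(ℝ, ℂ)) : convS f 0 = 0 := by
  simp [convS]

lemma convS_zero_left (f : 𝓢(ℝ, ℂ)) : convS 0 f = 0 := by
  simp [convS]

/-- The summand of the bilinear operator as a Schwartz function. -/
lemma bilinearTerm_eq (f₁ f₂ : 𝓢(ℝ, ℂ)) (k l : ℤ) :
    bilinearTerm scaleFamily phaseFamily f₁ f₂ k l =
      convS (mulS (convS f₁ (scaleFamily k)) (conjS (convS (conjS f₂) (scaleFamily k))))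
        (phaseFamily k l) := by
  rw [bilinearTerm, reflect_scaleFamily, conv_coe f₁, conv_coe f₂, conjS_convS, conjS_conjS]
  exact conv_coe (mulS (convS f₁ (scaleFamily k)) (convS f₂ (conjS (scaleFamily k)))) _

/-- The first absolute moment of the Fourier transform. -/
def fourierMoment (f : 𝓢(ℝ, ℂ)) : ℝ := 2 * ∫ ξ, ‖ξ‖ ^ 1 * ‖𝓕 f ξ‖

lemma fourierMoment_nonneg (f : 𝓢(ℝ, ℂ)) : 0 ≤ fourierMoment f :=
  mul_nonneg zero_le_two (integral_nonneg fun _ => by positivity)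

/-- On the k-th band |ξ| exceeds 2^k / 2, so one factor |ξ| can be traded for the gain 2^(-k). -/
lemma norm_convS_scaleFamily_le (f : 𝓢(ℝ, ℂ)) (k : ℤ) (x : ℝ) :
    ‖convS f (scaleFamily k) x‖ ≤ fourierMoment f * ((2 : ℝ) ^ k)⁻¹ := by
  have h0 : (0 : ℝ) < 2 ^ k := by positivity
  refine (norm_convS_le_fourier _ _ _).trans ?_
  rw [fourierMoment, mul_comm 2, mul_assoc, ← integral_mul_const]
  refine integral_mono_of_nonneg (.of_forall fun _ => by positivity)
    (((𝓕 f).integrable_pow_mul volume 1).mul_const _) (.of_forall fun ξ => ?_)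
  simp only
  rw [scaleFamily, fourier_bandpass, smul_apply, smul_eq_mul, norm_mul]
  have hc : ‖(if 1 ≤ k then 1 else 0 : ℂ)‖ ≤ 1 := by split_ifs <;> simp
  rcases le_or_gt ξ (3 / 4 * (2 : ℝ) ^ k) with h | h
  · rw [bandSymbol_eq_zero_of_le k h]
    simp only [norm_zero, mul_zero]
    positivity
  · have h1 : 1 ≤ ‖ξ‖ * (2 * ((2 : ℝ) ^ k)⁻¹) := by
      rw [← div_eq_mul_inv, mul_div_assoc', le_div_iff₀ h0, Real.norm_of_nonneg (by linarith)]
      linarith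
    calc ‖𝓕 f ξ‖ * (_ * ‖bandSymbol k ξ‖) ≤ ‖𝓕 f ξ‖ * (1 * 1) := by
          gcongr; exact norm_bandSymbol_le_one k ξ
      _ ≤ ‖𝓕 f ξ‖ * (‖ξ‖ * (2 * ((2 : ℝ) ^ k)⁻¹)) := by rw [one_mul]; gcongr
      _ = _ := by ring

/-- The two inner convolutions give 4^(-k). As nonzero terms have 1 ≤ l ≤ k, one of the factors
2^(-k) can pay for the sum over l. -/
lemma norm_bilinearTerm_le (f₁ f₂ : 𝓢(ℝ, ℂ)) (k l : ℤ) (x : ℝ) :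
    ‖bilinearTerm scaleFamily phaseFamily f₁ f₂ k l x‖ ≤
      fourierMoment f₁ * fourierMoment (conjS f₂) * bandMass *
        ((1 / 2) ^ k.natAbs * (1 / 2) ^ l.natAbs) := by
  have hM : 0 ≤ fourierMoment f₁ * fourierMoment (conjS f₂) :=
    mul_nonneg (fourierMoment_nonneg _) (fourierMoment_nonneg _)
  have hR : 0 ≤ fourierMoment f₁ * fourierMoment (conjS f₂) * bandMass *
        ((1 / 2) ^ k.natAbs * (1 / 2) ^ l.natAbs) :=
    mul_nonneg (mul_nonneg hM bandMass_nonneg) (by positivity)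
  rw [bilinearTerm_eq]
  by_cases hp : blockPhase k l = 0
  · rw [phaseFamily, hp, bandpass_zero, convS_zero_right]
    simpa using hR
  obtain ⟨hl, hlk⟩ := le_of_blockPhase_ne_zero hp
  lift k to ℕ using by omega
  lift l to ℕ using by omega
  refine (norm_convS_le _ _ (fourierMoment f₁ * fourierMoment (conjS f₂) *
    ((1 / 2) ^ k * (1 / 2) ^ l)) (fun y => ?_) x).trans ?_
  · rw [mulS_apply, conjS_apply, norm_mul, RCLike.norm_conj]
    calc _ ≤ (fourierMoment f₁ * ((2 : ℝ) ^ (k : ℤ))⁻¹) *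
        (fourierMoment (conjS f₂) * ((2 : ℝ) ^ (k : ℤ))⁻¹) := by
          gcongr
          · exact mul_nonneg (fourierMoment_nonneg _) (by positivity)
          · exact norm_convS_scaleFamily_le _ _ _
          · exact norm_convS_scaleFamily_le _ _ _
      _ = fourierMoment f₁ * fourierMoment (conjS f₂) * ((1 / 2) ^ k * (1 / 2) ^ k) := by
          rw [zpow_natCast, ← inv_pow, one_div]; ring
      _ ≤ _ := by
          gcongr ?_ * (?_ * ?_)
          exact pow_le_pow_of_le_one (by norm_num) (by norm_num) (by omega)
  · simp only [Int.natAbs_natCast]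
    rw [mul_right_comm _ bandMass]
    gcongr
    exact integral_norm_bandpass_le (norm_blockPhase_le _ _) _

lemma summable_half_pow_natAbs : Summable fun k : ℤ => (1 / 2 : ℝ) ^ k.natAbs := by
  refine Summable.of_nat_of_neg ?_ ?_ <;>
  simpa using summable_geometric_two

lemma summable_bilinearTerm (f₁ f₂ : 𝓢(ℝ, ℂ)) (x : ℝ) :
    Summable fun q : ℤ × ℤ => bilinearTerm scaleFamily phaseFamily f₁ f₂ q.1 q.2 x := by
  refine Summable.of_norm_bounded
    ((Summable.mul_of_nonneg summable_half_pow_natAbs summable_half_pow_natAbs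
      (fun _ => by positivity) (fun _ => by positivity)).mul_left
        (fourierMoment f₁ * fourierMoment (conjS f₂) * bandMass)) fun q => ?_
  exact norm_bilinearTerm_le f₁ f₂ q.1 q.2 x

/-! ### Lacunary sums. -/

lemma integral_expTwoPi_int (m : ℤ) :
    ∫ x in (0 : ℝ)..1, expTwoPi (m * x) = if m = 0 then 1 else 0 := by
  split_ifs with h
  · simp [h]
  · have hc : (2 * Real.pi * m * Complex.I : ℂ) ≠ 0 := by
      simp [Real.pi_ne_zero, h]
    have h1 : ∀ x : ℝ, expTwoPi (m * x) = Complex.exp ((2 * Real.pi * m * Complex.I) * x) := by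
      intro x; rw [expTwoPi]; congr 1; push_cast; ring
    simp_rw [h1]
    rw [integral_exp_mul_complex hc, ← h1, ← h1]
    have := expTwoPi_intCast m
    simp [this]

/-- Parseval's identity for exponential sums whose frequencies may coincide. -/
lemma integral_norm_sq_expSum {ι : Type*} (s : Finset ι) (a : ι → ℝ) (n : ι → ℤ) :
    ∫ x in (0 : ℝ)..1, ‖∑ i ∈ s, (a i : ℂ) * expTwoPi (n i * x)‖ ^ 2 =
      ∑ i ∈ s, ∑ j ∈ s, if n i = n j then a i * a j else 0 := by
  have h1 : ∀ x : ℝ, ((‖∑ i ∈ s, (a i : ℂ) * expTwoPi (n i * x)‖ ^ 2 : ℝ) : ℂ) =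
      ∑ i ∈ s, ∑ j ∈ s, (a i * a j : ℂ) * expTwoPi ((n i - n j : ℤ) * x) := by
    intro x
    rw [Complex.ofReal_pow, ← Complex.mul_conj', map_sum, Finset.sum_mul_sum]
    refine Finset.sum_congr rfl fun i _ => Finset.sum_congr rfl fun j _ => ?_
    rw [map_mul, Complex.conj_ofReal, conj_expTwoPi, mul_mul_mul_comm, ← expTwoPi_add]
    congr 2
    push_cast; ring
  have h2 : ((∫ x in (0 : ℝ)..1, ‖∑ i ∈ s, (a i : ℂ) * expTwoPi (n i * x)‖ ^ 2 : ℝ) : ℂ) =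
      ((∑ i ∈ s, ∑ j ∈ s, if n i = n j then a i * a j else 0 : ℝ) : ℂ) := by
    rw [← intervalIntegral.integral_ofReal]
    simp_rw [h1]
    rw [intervalIntegral.integral_finsetSum fun i _ =>
      Continuous.intervalIntegrable (by fun_prop) _ _, Complex.ofReal_sum]
    refine Finset.sum_congr rfl fun i _ => ?_
    rw [intervalIntegral.integral_finsetSum fun i _ =>
      Continuous.intervalIntegrable (by fun_prop) _ _, Complex.ofReal_sum]
    refine Finset.sum_congr rfl fun j _ => ?_
    rw [intervalIntegral.integral_const_mul, integral_expTwoPi_int]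
    simp only [sub_eq_zero]
    split_ifs <;> simp
  exact_mod_cast h2

lemma two_pow_add_two_pow_inj {a b c d : ℕ} (h : 2 ^ a + 2 ^ b = 2 ^ c + 2 ^ d) :
    (a = c ∧ b = d) ∨ (a = d ∧ b = c) := by
  have key : ∀ a b c d : ℕ, a ≤ b → c ≤ d → 2 ^ a + 2 ^ b = 2 ^ c + 2 ^ d → b ≤ d := by
    intro a b c d _ hcd h
    by_contra! hbd
    have h1 : 2 ^ (d + 1) ≤ 2 ^ b := Nat.pow_le_pow_right two_pos hbd
    have h2 : 2 ^ c ≤ 2 ^ d := Nat.pow_le_pow_right two_pos hcd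
    have h3 : 0 < 2 ^ a := by positivity
    rw [pow_succ] at h1
    omega
  have main : ∀ a b c d : ℕ, a ≤ b → c ≤ d → 2 ^ a + 2 ^ b = 2 ^ c + 2 ^ d → a = c ∧ b = d := by
    intro a b c d hab hcd h
    have hbd := le_antisymm (key a b c d hab hcd h) (key c d a b hcd hab h.symm)
    subst hbd
    exact ⟨Nat.pow_right_injective le_rfl (Nat.add_right_cancel h), rfl⟩
  rcases le_total a b with hab | hab <;> rcases le_total c d with hcd | hcd
  · exact .inl (main a b c d hab hcd h)
  · exact .inr (main a b d c hab hcd (by omega))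
  · exact .inr (main b a c d hab hcd (by omega)).symm
  · exact .inl (main b a d c hab hcd (by omega)).symm

/-- The lacunary sum `∑ l ∈ s, c l * exp (2πi 2^l x)`. -/
def lacSum (s : Finset ℕ) (c : ℕ → ℝ) (x : ℝ) : ℂ :=
  ∑ l ∈ s, (c l : ℂ) * expTwoPi (((2 ^ l : ℕ) : ℤ) * x)

@[fun_prop] lemma continuous_lacSum (s : Finset ℕ) (c : ℕ → ℝ) : Continuous (lacSum s c) := by
  unfold lacSum; fun_prop

lemma integral_norm_sq_lacSum (s : Finset ℕ) (c : ℕ → ℝ) :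
    ∫ x in (0 : ℝ)..1, ‖lacSum s c x‖ ^ 2 = ∑ l ∈ s, c l ^ 2 := by
  unfold lacSum
  rw [integral_norm_sq_expSum s c (fun l => ((2 ^ l : ℕ) : ℤ))]
  refine Finset.sum_congr rfl fun i hi => ?_
  have : ∀ j, (((2 ^ i : ℕ) : ℤ) = ((2 ^ j : ℕ) : ℤ)) ↔ i = j := fun j => by
    rw [Nat.cast_inj]; exact Nat.pow_right_inj one_lt_two
  simp only [this, Finset.sum_ite_eq, hi, if_true, sq]

/-- Apply Parseval to the square of the sum. By `two_pow_add_two_pow_inj` a frequency 2^i + 2^j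
determines the pair up to order, so each pair correlates only with itself and its swap. -/
lemma integral_norm_pow_four_lacSum_le (s : Finset ℕ) (c : ℕ → ℝ) (hc : ∀ l, 0 ≤ c l) :
    ∫ x in (0 : ℝ)..1, ‖lacSum s c x‖ ^ 4 ≤ 2 * (∑ l ∈ s, c l ^ 2) ^ 2 := by
  have h1 : ∀ x, ‖lacSum s c x‖ ^ 4 = ‖∑ p ∈ s ×ˢ s, ((c p.1 * c p.2 : ℝ) : ℂ) *
      expTwoPi (((2 ^ p.1 + 2 ^ p.2 : ℕ) : ℤ) * x)‖ ^ 2 := by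
    intro x
    have : lacSum s c x ^ 2 = ∑ p ∈ s ×ˢ s, ((c p.1 * c p.2 : ℝ) : ℂ) *
      expTwoPi (((2 ^ p.1 + 2 ^ p.2 : ℕ) : ℤ) * x) := by
      rw [sq, lacSum, Finset.sum_mul_sum, Finset.sum_product]
      refine Finset.sum_congr rfl fun i _ => Finset.sum_congr rfl fun j _ => ?_
      rw [mul_mul_mul_comm, ← expTwoPi_add, Complex.ofReal_mul]
      congr 2
      push_cast; ring
    rw [← this, norm_pow, ← pow_mul]
  simp_rw [h1]
  rw [integral_norm_sq_expSum (s ×ˢ s) (fun p => c p.1 * c p.2)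
    (fun p => ((2 ^ p.1 + 2 ^ p.2 : ℕ) : ℤ))]
  have h2 : (∑ l ∈ s, c l ^ 2) ^ 2 = ∑ p ∈ s ×ˢ s, (c p.1 * c p.2) ^ 2 := by
    rw [sq, Finset.sum_mul_sum, Finset.sum_product]
    simp only [mul_pow]
  rw [h2, Finset.mul_sum]
  refine Finset.sum_le_sum fun p hp => ?_
  have hp' : p.swap ∈ s ×ˢ s := by
    rw [Finset.mem_product] at hp ⊢; exact hp.symm
  calc _ ≤ ∑ q ∈ s ×ˢ s, ((if p = q then (c p.1 * c p.2) ^ 2 else 0) +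
        if p.swap = q then (c p.1 * c p.2) ^ 2 else 0) := by
        refine Finset.sum_le_sum fun q _ => ?_
        have hn := mul_nonneg (hc p.1) (hc p.2)
        split_ifs with h3 h4 h5 h5 h4 h5 h5
        · subst h4; nlinarith
        · subst h4; nlinarith
        · subst h5
          simp only [Prod.fst_swap, Prod.snd_swap]; nlinarith
        · exfalso
          rw [Nat.cast_inj] at h3
          rcases two_pow_add_two_pow_inj h3 with h | h
          · exact h4 (Prod.ext h.1 h.2)
          · exact h5 (Prod.ext h.2 h.1)
        all_goals positivity
    _ = _ := by
        rw [Finset.sum_add_distrib, Finset.sum_ite_eq, Finset.sum_ite_eq, if_pos hp, if_pos hp',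
          two_mul]

/-- A lacunary sum is comparable to its `L²` norm on a large part of a period. -/
lemma one_eighth_le_measure_lacSum (s : Finset ℕ) (c : ℕ → ℝ) (hc : ∀ l, 0 ≤ c l)
    (hA : 0 < ∑ l ∈ s, c l ^ 2) :
    1 / 8 ≤ volume.real
      (Set.Ioc (0 : ℝ) 1 ∩ {x | (∑ l ∈ s, c l ^ 2) / 2 ≤ ‖lacSum s c x‖ ^ 2}) := by
  set A := ∑ l ∈ s, c l ^ 2
  set E := {x | A / 2 ≤ ‖lacSum s c x‖ ^ 2}
  have hE : MeasurableSet E :=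
    measurableSet_le measurable_const (by fun_prop : Continuous fun x => ‖lacSum s c x‖ ^ 2).measurable
  have hI2 : IntervalIntegrable (fun x => ‖lacSum s c x‖ ^ 2) volume 0 1 :=
    Continuous.intervalIntegrable (by fun_prop) _ _
  have hI4 : IntervalIntegrable (fun x => A / 2 + ‖lacSum s c x‖ ^ 4 / (8 * A)) volume 0 1 :=
    Continuous.intervalIntegrable (by fun_prop) _ _
  have hIE : IntervalIntegrable (E.indicator fun _ => 2 * A) volume 0 1 := by
    rw [intervalIntegrable_iff, Set.uIoc_of_le zero_le_one]
    exact (integrable_const _).indicator hE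
  have hmono : ∫ x in (0 : ℝ)..1, ‖lacSum s c x‖ ^ 2 ≤
      ∫ x in (0 : ℝ)..1, (A / 2 + ‖lacSum s c x‖ ^ 4 / (8 * A)) + E.indicator (fun _ => 2 * A) x := by
    refine intervalIntegral.integral_mono_on zero_le_one hI2 (hI4.add hIE) fun x _ => ?_
    by_cases hx : x ∈ E
    · rw [Set.indicator_of_mem hx]
      -- With t = ‖lacSum s c x‖², this square gives t ≤ t²/(8A) + 2A. After integration the bound
      -- reads A ≤ A/2 + A/4 + 2A|E|, whence 1/8.
      have h1 : 0 ≤ (‖lacSum s c x‖ ^ 2 - 4 * A) ^ 2 / (8 * A) := by positivity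
      have h2 : (‖lacSum s c x‖ ^ 2 - 4 * A) ^ 2 / (8 * A) =
          ‖lacSum s c x‖ ^ 4 / (8 * A) - ‖lacSum s c x‖ ^ 2 + 2 * A := by
        field_simp; ring
      linarith
    · rw [Set.indicator_of_notMem hx]
      have h1 : ‖lacSum s c x‖ ^ 2 < A / 2 := not_le.1 hx
      have h2 : 0 ≤ ‖lacSum s c x‖ ^ 4 / (8 * A) := by positivity
      linarith
  rw [intervalIntegral.integral_add hI4 hIE, intervalIntegral.integral_add
    (Continuous.intervalIntegrable (by fun_prop) _ _)
    (Continuous.intervalIntegrable (by fun_prop) _ _), integral_norm_sq_lacSum,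
    intervalIntegral.integral_div (f := fun x => ‖lacSum s c x‖ ^ 4), intervalIntegral.integral_of_le zero_le_one
      (f := E.indicator fun _ => 2 * A),
    setIntegral_indicator hE, setIntegral_const, smul_eq_mul] at hmono
  have h4 : (∫ x in (0 : ℝ)..1, ‖lacSum s c x‖ ^ 4) / (8 * A) ≤ A / 4 := by
    rw [div_le_iff₀ (by positivity)]
    have := integral_norm_pow_four_lacSum_le s c hc
    calc _ ≤ 2 * A ^ 2 := this
      _ = _ := by ring
  simp only [intervalIntegral.integral_const, sub_zero, one_smul] at hmono
  have h5 : A * (1 / 8) ≤ A * volume.real (Set.Ioc (0 : ℝ) 1 ∩ E) := by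
    change A ≤ _ at hmono
    linarith
  exact le_of_mul_le_mul_left h5 hA

/-! ### The band-limited window. -/

/-- A smooth bump supported in `(-1/16, 1/16)`. -/
def lowBump : ContDiffBump (0 : ℝ) := ⟨1 / 32, 1 / 16, by norm_num, by norm_num⟩

/-- A real band-limited Schwartz function which is bounded below on `[0, 1]`. -/
def window : 𝓢(ℝ, ℂ) := 𝓕 lowBump.toSchwartz

lemma fourier_fourier_apply (f : 𝓢(ℝ, ℂ)) (ξ : ℝ) : 𝓕 (𝓕 f) ξ = f (-ξ) := by
  rw [← neg_neg ξ, fourier_apply_neg, fourierInv_fourier_eq, neg_neg]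

lemma lowBump_eq_zero {ξ : ℝ} (h : 1 / 16 ≤ |ξ|) : lowBump ξ = 0 :=
  lowBump.zero_of_le_dist (by rw [Real.dist_eq, sub_zero]; exact h)

lemma abs_lt_of_fourier_window_ne_zero {ξ : ℝ} (h : 𝓕 window ξ ≠ 0) : |ξ| < 1 / 16 := by
  by_contra! h'
  apply h
  rw [window, fourier_fourier_apply, ContDiffBump.toSchwartz_apply, lowBump_eq_zero (by simpa using h')]
  simp

lemma abs_lt_of_fourier_window_sq_ne_zero {ξ : ℝ} (h : 𝓕 (mulS window window) ξ ≠ 0) :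
    |ξ| < 1 / 8 := by
  by_contra! h'
  apply h
  rw [window, ← fourier_convS, fourier_fourier_apply, ← conv_coe]
  simp only [conv, convolution_def, ContinuousLinearMap.mul_apply', ContDiffBump.toSchwartz_apply]
  rw [← integral_zero ℝ ℂ]
  congr 1; ext t
  rcases le_or_gt (1 / 16) |t| with ht | ht
  · simp [lowBump_eq_zero ht]
  · rw [lowBump_eq_zero (ξ := -ξ - t)]
    · simp
    · have := abs_sub_abs_le_abs_sub (-ξ) t
      rw [abs_neg] at this
      linarith

lemma conj_window (x : ℝ) : (starRingEnd ℂ) (window x) = window x := by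
  rw [window, fourier_apply_eq_integral, ← integral_conj, ← integral_neg_eq_self]
  congr 1; ext ξ
  rw [map_mul, conj_expTwoPi, ContDiffBump.toSchwartz_apply, ContDiffBump.toSchwartz_apply,
    Complex.conj_ofReal, lowBump.neg]
  congr 2
  ring

/-- A lower bound for the window on `[0, 1]`. -/
def windowBound : ℝ := 1 / 2 * ∫ ξ, lowBump ξ

lemma windowBound_pos : 0 < windowBound := mul_pos (by norm_num) lowBump.integral_pos

lemma expTwoPi_re (t : ℝ) : (expTwoPi t).re = Real.cos (2 * Real.pi * t) := by
  have : (2 * Real.pi * t * Complex.I : ℂ) = ((2 * Real.pi * t : ℝ) : ℂ) * Complex.I := by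
    push_cast; ring
  rw [expTwoPi, this, Complex.exp_ofReal_mul_I_re]

/-- For |ξ| < 1/16 and 0 < x ≤ 1 the phase of the Fourier integral is so small that its cosine is at
least 1/2. -/
lemma windowBound_le {x : ℝ} (hx : x ∈ Set.Ioc (0 : ℝ) 1) : windowBound ≤ ‖window x‖ := by
  have hint : Integrable fun ξ => expTwoPi (-(ξ * x)) * lowBump.toSchwartz ξ := by
    refine lowBump.toSchwartz.integrable.bdd_mul (c := 1) (by fun_prop) ?_
    exact .of_forall fun ξ => by simp
  refine le_trans ?_ (Complex.re_le_norm _)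
  rw [window, fourier_apply_eq_integral, windowBound, ← integral_const_mul]
  refine le_of_le_of_eq ?_ (integral_re hint)
  refine integral_mono (lowBump.integrable.const_mul _) hint.re fun ξ => ?_
  simp only [RCLike.re_to_complex]
  rw [ContDiffBump.toSchwartz_apply, Complex.re_mul_ofReal, expTwoPi_re]
  rcases le_or_gt (1 / 16) |ξ| with h | h
  · simp [lowBump_eq_zero h]
  · gcongr
    · exact lowBump.nonneg
    · refine le_trans ?_ (Real.one_sub_sq_div_two_le_cos)
      have h1 : |ξ * x| ≤ 1 / 16 := by
        rw [abs_mul, abs_of_pos hx.1]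
        calc _ ≤ (1 / 16) * (1 : ℝ) := mul_le_mul h.le hx.2 hx.1.le (by norm_num)
          _ = _ := mul_one _
      have h2 : (ξ * x) ^ 2 ≤ (1 / 16) ^ 2 := by
        rw [← sq_abs]; gcongr
      have h3 : Real.pi ^ 2 ≤ 4 ^ 2 := by
        have := Real.pi_pos; have := Real.pi_le_four; gcongr
      have h4 : (2 * Real.pi * -(ξ * x)) ^ 2 = 4 * (Real.pi ^ 2 * (ξ * x) ^ 2) := by ring
      have h5 : Real.pi ^ 2 * (ξ * x) ^ 2 ≤ 4 ^ 2 * (1 / 16) ^ 2 := by gcongr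
      rw [h4]
      linarith

/-! ### Fejér kernels and wave packets. -/

/-- The sum of `exp (2πimk/n)` over a full period of `k`. -/
lemma sum_Ico_expTwoPi {n : ℕ} (hn : 0 < n) (m : ℤ) :
    ∑ k ∈ Finset.Ico n (2 * n), expTwoPi (m * k / n) = if (n : ℤ) ∣ m then (n : ℂ) else 0 := by
  have hn' : (n : ℝ) ≠ 0 := by positivity
  have h1 : ∑ k ∈ Finset.Ico n (2 * n), expTwoPi (m * k / n) =
      ∑ k ∈ Finset.range n, expTwoPi (m / n) ^ k := by
    rw [Finset.sum_Ico_eq_sum_range, two_mul, Nat.add_sub_cancel]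
    refine Finset.sum_congr rfl fun k _ => ?_
    rw [expTwoPi_pow]
    have : (m : ℝ) * ((n + k : ℕ) : ℝ) / n = m + k * (m / n) := by
      push_cast; field_simp
    rw [this, expTwoPi_add, expTwoPi_intCast, one_mul]
  have h2 : expTwoPi (m / n) = 1 ↔ (n : ℤ) ∣ m := by
    rw [expTwoPi_eq_one_iff]
    refine exists_congr fun t => ?_
    rw [div_eq_iff hn']
    constructor
    · intro h
      have : m = t * n := by exact_mod_cast h
      rw [this, mul_comm]
    · rintro rfl
      push_cast; ring
  rw [h1]
  split_ifs with h
  · simp [h2.2 h]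
  · rw [geom_sum_eq (fun h' => h (h2.1 h')), expTwoPi_pow, mul_div_cancel₀ _ hn', expTwoPi_intCast,
      sub_self, zero_div]

/-- The index set of the double sum expanding the Fejér kernel. -/
def fejerIndex (n : ℕ) : Finset (ℕ × ℕ) := Finset.range n ×ˢ Finset.range n

/-- The difference of the two coordinates. -/
def indexDiff (p : ℕ × ℕ) : ℤ := (p.1 : ℤ) - p.2

lemma abs_indexDiff_lt {n : ℕ} {p : ℕ × ℕ} (hp : p ∈ fejerIndex n) :
    |indexDiff p| < n := by
  rw [fejerIndex, Finset.mem_product, Finset.mem_range, Finset.mem_range] at hp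
  rw [indexDiff, abs_lt]
  omega

/-- The Fejér kernel of order `n` divided by `n`. -/
def fejer (n : ℕ) (y : ℝ) : ℝ := ‖(n : ℂ)⁻¹ * ∑ m ∈ Finset.range n, expTwoPi (m * y)‖ ^ 2

lemma fejer_nonneg (n : ℕ) (y : ℝ) : 0 ≤ fejer n y := by unfold fejer; positivity

lemma fejer_eq_sum (n : ℕ) (y : ℝ) :
    (fejer n y : ℂ) = ((n : ℂ)⁻¹) ^ 2 * ∑ p ∈ fejerIndex n, expTwoPi (indexDiff p * y) := by
  rw [fejer, Complex.ofReal_pow, ← Complex.mul_conj', map_mul, map_sum, mul_mul_mul_comm,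
    Finset.sum_mul_sum, fejerIndex, Finset.sum_product]
  congr 1
  · rw [map_inv₀, Complex.conj_natCast, sq]
  · refine Finset.sum_congr rfl fun i _ => Finset.sum_congr rfl fun j _ => ?_
    rw [conj_expTwoPi, ← expTwoPi_add, indexDiff]
    congr 1
    push_cast; ring

/-- The equidistributed translates of the Fejér kernel form a partition of unity. -/
lemma sum_fejer_translate {n : ℕ} (hn : 0 < n) (x : ℝ) :
    ∑ k ∈ Finset.Ico n (2 * n), fejer n (x - k / n) = 1 := by
  have hn' : (n : ℂ) ≠ 0 := by exact_mod_cast hn.ne'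
  rw [← Complex.ofReal_inj, Complex.ofReal_sum]
  simp_rw [fejer_eq_sum]
  rw [← Finset.mul_sum, Finset.sum_comm]
  have h1 : ∀ p ∈ fejerIndex n, ∑ k ∈ Finset.Ico n (2 * n), expTwoPi (indexDiff p * (x - k / n)) =
      if p.1 = p.2 then (n : ℂ) else 0 := by
    intro p hp
    have h2 : ∀ k : ℕ, expTwoPi (indexDiff p * (x - k / n)) =
        expTwoPi (indexDiff p * x) * expTwoPi ((-indexDiff p : ℤ) * k / n) := by
      intro k
      rw [← expTwoPi_add]; congr 1; push_cast; ring
    -- The frequencies of the kernel are smaller than n in absolute value, so only the zero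
    -- frequency survives the sum over k.
    have h3 : (n : ℤ) ∣ -indexDiff p ↔ p.1 = p.2 := by
      rw [dvd_neg]
      constructor
      · intro h
        have := Int.eq_zero_of_abs_lt_dvd h (abs_indexDiff_lt hp)
        rw [indexDiff] at this
        omega
      · intro h
        simp [indexDiff, h]
    simp_rw [h2]
    rw [← Finset.mul_sum, sum_Ico_expTwoPi hn]
    simp only [h3]
    split_ifs with h
    · simp [indexDiff, h]
    · simp
  rw [Finset.sum_congr rfl h1, fejerIndex, Finset.sum_product]
  have h4 : ∀ i ∈ Finset.range n, ∑ j ∈ Finset.range n, (if i = j then (n : ℂ) else 0) = n := by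
    intro i hi
    rw [Finset.sum_ite_eq, if_pos hi]
  rw [Finset.sum_congr rfl h4, Finset.sum_const, Finset.card_range, nsmul_eq_mul]
  simp only [Complex.ofReal_one]
  field_simp

/-- The wave packet `exp (2πi2^k x) fejer n (x - k/n) window x`. -/
def packet (n k : ℕ) : 𝓢(ℝ, ℂ) :=
  ((n : ℂ)⁻¹) ^ 2 • ∑ p ∈ fejerIndex n,
    expTwoPi (-(indexDiff p * (k / n))) • modS (2 ^ k + indexDiff p) window

lemma packet_apply (n k : ℕ) (x : ℝ) :
    packet n k x = expTwoPi (2 ^ k * x) * window x * fejer n (x - k / n) := by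
  rw [packet, smul_apply, sum_apply, smul_eq_mul, fejer_eq_sum,
    mul_left_comm (expTwoPi (2 ^ k * x) * window x)]
  congr 1
  rw [Finset.mul_sum]
  refine Finset.sum_congr rfl fun p _ => ?_
  have : (indexDiff p : ℝ) * (x - k / n) = indexDiff p * x + -(indexDiff p * (k / n)) := by ring
  rw [smul_apply, modS_apply, smul_eq_mul, this, expTwoPi_add, add_mul, expTwoPi_add]
  ring

/-- The test function made of the wave packets of scales `n ≤ k < 2n`. -/
def testFunction (n : ℕ) : 𝓢(ℝ, ℂ) := ∑ k ∈ Finset.Ico n (2 * n), packet n k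

lemma norm_testFunction_le {n : ℕ} (hn : 0 < n) (x : ℝ) : ‖testFunction n x‖ ≤ ‖window x‖ := by
  rw [testFunction, sum_apply]
  calc _ ≤ ∑ k ∈ Finset.Ico n (2 * n), ‖window x‖ * fejer n (x - k / n) := by
        refine norm_sum_le_of_le _ fun k _ => ?_
        rw [packet_apply, norm_mul, norm_mul, norm_expTwoPi, one_mul, Complex.norm_real,
          Real.norm_of_nonneg (fejer_nonneg _ _)]
    _ = _ := by rw [← Finset.mul_sum, sum_fejer_translate hn, mul_one]

lemma fourier_scaleFamily_eq {k' : ℕ} (hk' : 1 ≤ k') (k : ℤ) {ξ : ℝ}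
    (hξ : |ξ - 2 ^ k'| ≤ 2 ^ k' / 8) :
    𝓕 (scaleFamily k) ξ = if k = k' then 1 else 0 := by
  rw [abs_le] at hξ
  have hz : (2 : ℝ) ^ (k' : ℤ) = 2 ^ k' := zpow_natCast _ _
  have hpos : (0 : ℝ) < 2 ^ k' := by positivity
  rw [scaleFamily, fourier_bandpass, smul_apply, smul_eq_mul]
  rcases lt_trichotomy k k' with h | h | h
  · rw [bandSymbol_eq_zero_of_ge, if_neg h.ne, mul_zero]
    have h1 : (2 : ℝ) ^ (k + 1) ≤ 2 ^ (k' : ℤ) := zpow_le_zpow_right₀ one_le_two h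
    rw [zpow_add_one₀ two_ne_zero, hz] at h1
    linarith
  · subst h
    rw [if_pos (by exact_mod_cast hk'), bandSymbol_eq_one] <;> simp <;> linarith
  · rw [bandSymbol_eq_zero_of_le, if_neg h.ne', mul_zero]
    have h1 : (2 : ℝ) ^ ((k' : ℤ) + 1) ≤ 2 ^ k := zpow_le_zpow_right₀ one_le_two h
    rw [zpow_add_one₀ two_ne_zero, hz] at h1
    linarith

/-- The packet has frequencies within n ≤ 2^k'/8 of 2^k', where the symbol of scale k' equals 1 and
all others vanish. -/
lemma convS_packet_scaleFamily {n k' : ℕ} (hk' : 1 ≤ k') (hn : 8 * n ≤ 2 ^ k') (k : ℤ) :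
    convS (packet n k') (scaleFamily k) = if k = k' then packet n k' else 0 := by
  have hn' : (8 * n : ℝ) ≤ 2 ^ k' := by exact_mod_cast hn
  have h1 : ∀ p ∈ fejerIndex n, convS (modS (2 ^ k' + indexDiff p) window) (scaleFamily k) =
      (if k = k' then (1 : ℂ) else 0) • modS (2 ^ k' + indexDiff p) window := by
    intro p hp
    refine convS_modS _ _ _ _ fun ξ hξ => fourier_scaleFamily_eq hk' k ?_
    have h2 := abs_lt_of_fourier_window_ne_zero hξ
    have h3 : (|indexDiff p| : ℝ) + 1 ≤ n := by exact_mod_cast abs_indexDiff_lt hp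
    have h4 : (2 : ℝ) ^ k' + indexDiff p + ξ - 2 ^ k' = indexDiff p + ξ := by ring
    rw [h4]
    have := abs_add_le (indexDiff p : ℝ) ξ
    linarith
  rw [packet, convS_smul_left, convS_sum_left, Finset.sum_congr rfl fun p hp => by
    rw [convS_smul_left, h1 p hp]]
  split_ifs <;> simp

lemma eight_mul_le_two_pow {L k : ℕ} (hL : 3 ≤ L) (hk : 2 ^ L ≤ k) : 8 * 2 ^ L ≤ 2 ^ k := by
  have h1 : L + 3 ≤ 2 ^ L := by
    induction L, hL using Nat.le_induction with
    | base => norm_num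
    | succ m hm ih => have := ih ((Nat.pow_le_pow_right two_pos m.le_succ).trans hk); omega
  calc 8 * 2 ^ L = 2 ^ (L + 3) := by ring
    _ ≤ _ := Nat.pow_le_pow_right two_pos (h1.trans hk)

lemma convS_testFunction_scaleFamily {L : ℕ} (hL : 3 ≤ L) (k : ℤ) :
    convS (testFunction (2 ^ L)) (scaleFamily k) =
      ∑ k' ∈ Finset.Ico (2 ^ L) (2 * 2 ^ L), if k = (k' : ℕ) then packet (2 ^ L) k' else 0 := by
  rw [testFunction, convS_sum_left]
  refine Finset.sum_congr rfl fun k' hk' => ?_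
  rw [Finset.mem_Ico] at hk'
  exact convS_packet_scaleFamily (Nat.one_le_two_pow.trans hk'.1)
    (eight_mul_le_two_pow hL hk'.1) k

/-! ### Squared packets and the resonant frequencies 2^l. -/

/-- The index set expanding the square of the Fejér kernel. -/
def quadIndex (n : ℕ) : Finset ((ℕ × ℕ) × (ℕ × ℕ)) := fejerIndex n ×ˢ fejerIndex n

/-- The frequency attached to an element of `quadIndex`. -/
def quadFreq (q : (ℕ × ℕ) × (ℕ × ℕ)) : ℤ := indexDiff q.1 + indexDiff q.2

/-- The carrier exp(2πi 2^k x) cancels; k then enters only through the phases on which the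
cancellation in `sum_convS_packet` acts. -/
lemma packet_mul_conj (n k : ℕ) :
    mulS (packet n k) (conjS (packet n k)) =
      ((n : ℂ)⁻¹) ^ 4 • ∑ q ∈ quadIndex n,
        expTwoPi (-(quadFreq q * (k / n))) • modS (quadFreq q) (mulS window window) := by
  ext x
  have h1 : mulS (packet n k) (conjS (packet n k)) x =
      (window x * window x) * ((fejer n (x - k / n) : ℂ) * fejer n (x - k / n)) := by
    rw [mulS_apply, conjS_apply, packet_apply, map_mul, map_mul, Complex.conj_ofReal, conj_window,
      conj_expTwoPi]
    have : expTwoPi (2 ^ k * x) * expTwoPi (-(2 ^ k * x)) = 1 := by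
      rw [← expTwoPi_add, add_neg_cancel, expTwoPi_zero]
    linear_combination (window x * window x) *
      ((fejer n (x - k / n) : ℂ) * fejer n (x - k / n)) * this
  rw [h1, smul_apply, sum_apply, smul_eq_mul, fejer_eq_sum,
    mul_mul_mul_comm (((n : ℂ)⁻¹) ^ 2), ← pow_add,
    mul_left_comm, Finset.sum_mul_sum, quadIndex, Finset.sum_product]
  congr 1
  rw [Finset.mul_sum]
  refine Finset.sum_congr rfl fun p _ => ?_
  rw [Finset.mul_sum]
  refine Finset.sum_congr rfl fun p' _ => ?_
  rw [smul_apply, modS_apply, smul_eq_mul, mulS_apply, ← expTwoPi_add, ← mul_assoc (expTwoPi _),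
    ← expTwoPi_add, mul_comm]
  congr 2
  rw [quadFreq]
  push_cast; ring

/-- The number of representations of `2 ^ l` as a frequency, normalized. -/
def quadCoeff (n l : ℕ) : ℝ :=
  ((n : ℝ)⁻¹) ^ 3 * ((quadIndex n).filter fun q => quadFreq q = 2 ^ l).card

lemma quadCoeff_nonneg (n l : ℕ) : 0 ≤ quadCoeff n l := by unfold quadCoeff; positivity

lemma card_filter_quadFreq_ge {m a : ℕ} (ha : a ≤ m) :
    m ^ 3 ≤ ((quadIndex (4 * m)).filter fun q => quadFreq q = a).card := by
  have h1 : (Finset.range m ×ˢ Finset.range m ×ˢ Finset.range m).card = m ^ 3 := by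
    simp only [Finset.card_product, Finset.card_range]; ring
  rw [← h1]
  refine Finset.card_le_card_of_injOn
    -- Three coordinates are free and the fourth is forced by the frequency. The shift by m prevents
    -- truncation of the subtraction, and a ≤ m keeps the entry below 4m.
    (fun t => ((a + m + t.1 + t.2.1 - t.2.2, m + t.1), (m + t.2.2, m + t.2.1))) ?_ ?_
  · rintro ⟨i, j, t⟩ h
    simp only [Finset.coe_product, Set.mem_prod, Finset.mem_coe, Finset.mem_range] at h
    refine Finset.mem_coe.2 (Finset.mem_filter.2 ⟨?_, ?_⟩)
    · simp only [quadIndex, fejerIndex, Finset.mem_product, Finset.mem_range]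
      omega
    · simp only [quadFreq, indexDiff]
      omega
  · rintro ⟨i, j, t⟩ _ ⟨i', j', t'⟩ _ h
    simp only [Prod.mk.injEq] at h ⊢
    omega

lemma one_div_le_quadCoeff {L l : ℕ} (hl : l + 2 ≤ L) : 1 / 64 ≤ quadCoeff (2 ^ L) l := by
  obtain ⟨M, rfl⟩ := Nat.exists_eq_add_of_le' (le_trans (Nat.le_add_left 2 l) hl)
  have h1 := card_filter_quadFreq_ge (m := 2 ^ M) (a := 2 ^ l)
    (Nat.pow_le_pow_right two_pos (by omega))
  have h2 : 2 ^ (M + 2) = 4 * 2 ^ M := by ring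
  rw [quadCoeff, h2]
  push_cast at h1 ⊢
  have h3 : ((2 : ℝ) ^ M) ^ 3 ≤
      ((quadIndex (4 * 2 ^ M)).filter fun q => quadFreq q = 2 ^ l).card := by exact_mod_cast h1
  have h4 : (0 : ℝ) < 2 ^ M := by positivity
  calc (1 / 64 : ℝ) = ((4 * (2 : ℝ) ^ M)⁻¹) ^ 3 * ((2 : ℝ) ^ M) ^ 3 := by
        field_simp; norm_num
    _ ≤ _ := by gcongr

/-- Any other s in the residue class of 2^l mod n is at least 5·2^l or at most -3·2^l, hence misses
the l-th band. This is why phases are switched on only for l + 2 ≤ L. -/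
lemma convS_modS_bandpass {n l : ℕ} (hl : 1 ≤ l) (hn : 4 * 2 ^ l ≤ n) {s : ℤ}
    (hs : (n : ℤ) ∣ 2 ^ l - s) :
    convS (modS s (mulS window window)) (bandpass 1 l) =
      if s = 2 ^ l then modS (2 ^ l) (mulS window window) else 0 := by
  have h2 : (2 : ℝ) ≤ 2 ^ l := by
    calc (2 : ℝ) = 2 ^ 1 := (pow_one _).symm
      _ ≤ 2 ^ l := pow_le_pow_right₀ one_le_two hl
  have hz : (2 : ℝ) ^ (l : ℤ) = 2 ^ l := zpow_natCast _ _
  split_ifs with h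
  · subst h
    push_cast
    rw [convS_modS _ _ _ 1, one_smul]
    intro ξ hξ
    have h3 := abs_lt.1 (abs_lt_of_fourier_window_sq_ne_zero hξ)
    rw [fourier_bandpass, one_smul]
    apply bandSymbol_eq_one <;> rw [hz] <;> linarith
  · rw [convS_modS _ _ _ 0, zero_smul]
    intro ξ hξ
    have h3 := abs_lt.1 (abs_lt_of_fourier_window_sq_ne_zero hξ)
    rw [fourier_bandpass, one_smul]
    obtain ⟨t, ht⟩ := hs
    have hn' : (4 * 2 ^ l : ℤ) ≤ n := by exact_mod_cast hn
    have h0 : (0 : ℤ) < 2 ^ l := by positivity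
    rcases lt_trichotomy t 0 with h4 | h4 | h4
    · apply bandSymbol_eq_zero_of_ge
      have h5 : (5 * 2 ^ l : ℤ) ≤ s := by nlinarith
      have h6 : (5 * 2 ^ l : ℝ) ≤ s := by exact_mod_cast h5
      rw [hz]; linarith
    · exact absurd (by rw [h4, mul_zero] at ht; omega) h
    · apply bandSymbol_eq_zero_of_le
      have h5 : s ≤ (-3 * 2 ^ l : ℤ) := by nlinarith
      have h6 : (s : ℝ) ≤ -3 * 2 ^ l := by exact_mod_cast h5
      rw [hz]; linarith

lemma log_two_of_mem_Ico {L k : ℕ} (hk : k ∈ Finset.Ico (2 ^ L) (2 * 2 ^ L)) :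
    Nat.log 2 k = L := by
  rw [Finset.mem_Ico] at hk
  exact Nat.log_eq_of_pow_le_of_lt_pow hk.1 (by rw [pow_succ]; omega)

lemma blockPhase_of_mem {L k : ℕ} (hk : k ∈ Finset.Ico (2 ^ L) (2 * 2 ^ L)) (l : ℤ) :
    blockPhase k l = if 1 ≤ l ∧ l + 2 ≤ (L : ℤ) then
      expTwoPi ((2 : ℝ) ^ l * k / (2 ^ L : ℕ)) else 0 := by
  rw [blockPhase, Int.toNat_natCast, log_two_of_mem_Ico hk]
  push_cast
  rfl

/-- Summing the products of packets against the phases isolates a single lacunary frequency. -/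
lemma sum_convS_packet {L l : ℕ} (hl : 1 ≤ l) (hL : l + 2 ≤ L) :
    ∑ k ∈ Finset.Ico (2 ^ L) (2 * 2 ^ L),
      convS (mulS (packet (2 ^ L) k) (conjS (packet (2 ^ L) k))) (phaseFamily k l) =
    (quadCoeff (2 ^ L) l : ℂ) • modS (2 ^ l) (mulS window window) := by
  have hn0 : 0 < 2 ^ L := by positivity
  have hn : 4 * 2 ^ l ≤ 2 ^ L := by
    calc 4 * 2 ^ l = 2 ^ (l + 2) := by ring
      _ ≤ 2 ^ L := Nat.pow_le_pow_right two_pos hL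
  set n := 2 ^ L with hndef
  have h1 : ∀ k ∈ Finset.Ico n (2 * n),
      convS (mulS (packet n k) (conjS (packet n k))) (phaseFamily k l) =
      ((n : ℂ)⁻¹) ^ 4 • ∑ q ∈ quadIndex n, expTwoPi ((2 ^ l - quadFreq q : ℤ) * k / n) •
        convS (modS (quadFreq q) (mulS window window)) (bandpass 1 l) := by
    intro k hk
    rw [phaseFamily, bandpass_eq_smul, blockPhase_of_mem hk, if_pos (by omega), packet_mul_conj,
      convS_smul_left, convS_sum_left]
    congr 1
    refine Finset.sum_congr rfl fun q _ => ?_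
    rw [convS_smul_left, convS_smul_right, smul_smul, ← expTwoPi_add, ← hndef]
    congr 2
    rw [zpow_natCast]
    push_cast; ring
  rw [Finset.sum_congr rfl h1, ← Finset.smul_sum, Finset.sum_comm]
  -- Orthogonality in k selects the residue class mod n, and the band-pass then selects one member
  -- of it.
  have h2 : ∀ q ∈ quadIndex n, ∑ k ∈ Finset.Ico n (2 * n),
      expTwoPi ((2 ^ l - quadFreq q : ℤ) * k / n) •
        convS (modS (quadFreq q) (mulS window window)) (bandpass 1 l) =
      if quadFreq q = 2 ^ l then (n : ℂ) • modS (2 ^ l) (mulS window window) else 0 := by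
    intro q _
    rw [← Finset.sum_smul, sum_Ico_expTwoPi hn0]
    by_cases hd : (n : ℤ) ∣ 2 ^ l - quadFreq q
    · rw [if_pos hd, convS_modS_bandpass hl hn hd, smul_ite, smul_zero]
    · rw [if_neg hd, zero_smul, if_neg]
      intro h
      exact hd (by simp [h])
  rw [Finset.sum_congr rfl h2, ← Finset.sum_filter, Finset.sum_const, ← Nat.cast_smul_eq_nsmul ℂ,
    smul_smul, smul_smul, quadCoeff]
  congr 1
  have : (n : ℂ) ≠ 0 := by exact_mod_cast hn0.ne'
  push_cast
  field_simp

/-- The bilinear operator on the test functions is a windowed lacunary sum. -/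
lemma bilinearOp_testFunction {L : ℕ} (hL : 3 ≤ L) (x : ℝ) :
    bilinearOp scaleFamily phaseFamily (testFunction (2 ^ L)) (conjS (testFunction (2 ^ L))) x =
      window x ^ 2 * lacSum (Finset.Icc 1 (L - 2)) (quadCoeff (2 ^ L)) x := by
  set K := Finset.Ico (2 ^ L) (2 * 2 ^ L)
  have hterm : ∀ k l : ℤ, bilinearTerm scaleFamily phaseFamily (testFunction (2 ^ L))
      (conjS (testFunction (2 ^ L))) k l = ∑ k' ∈ K, if k = (k' : ℕ) then
        convS (mulS (packet (2 ^ L) k') (conjS (packet (2 ^ L) k'))) (phaseFamily k l) else 0 := by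
    intro k l
    rw [bilinearTerm_eq, conjS_conjS, convS_testFunction_scaleFamily hL]
    by_cases hk : ∃ j ∈ K, k = (j : ℕ)
    · obtain ⟨j, hj, rfl⟩ := hk
      simp only [Nat.cast_inj]
      rw [Finset.sum_ite_eq, Finset.sum_ite_eq, if_pos hj, if_pos hj]
    · push Not at hk
      rw [Finset.sum_eq_zero fun j hj => if_neg (hk j hj),
        Finset.sum_eq_zero fun j hj => if_neg (hk j hj)]
      have : mulS 0 (conjS 0) = 0 := by ext; simp
      rw [this, convS_zero_left]
  have hval : ∀ k ∈ K, ∀ l : ℤ, bilinearTerm scaleFamily phaseFamily (testFunction (2 ^ L))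
      (conjS (testFunction (2 ^ L))) (k : ℕ) l =
        convS (mulS (packet (2 ^ L) k) (conjS (packet (2 ^ L) k))) (phaseFamily k l) := by
    intro k hk l
    rw [hterm]
    simp only [Nat.cast_inj]
    rw [Finset.sum_ite_eq, if_pos hk]
  have hk0 : ∀ k : ℤ, k ∉ K.map Nat.castEmbedding → ∀ l, bilinearTerm scaleFamily phaseFamily
      (testFunction (2 ^ L)) (conjS (testFunction (2 ^ L))) k l x = 0 := by
    intro k hk l
    rw [hterm, Finset.sum_eq_zero fun j hj => if_neg ?_]
    · rfl
    · rintro rfl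
      exact hk (Finset.mem_map_of_mem _ hj)
  have hl0 : ∀ k ∈ K, ∀ l : ℤ, l ∉ (Finset.Icc 1 (L - 2)).map Nat.castEmbedding →
      bilinearTerm scaleFamily phaseFamily (testFunction (2 ^ L))
        (conjS (testFunction (2 ^ L))) (k : ℕ) l x = 0 := by
    intro k hk l hl
    rw [hval k hk, phaseFamily, blockPhase_of_mem hk, if_neg, bandpass_zero, convS_zero_right]
    · rfl
    · rintro ⟨h1, h2⟩
      lift l to ℕ using by omega
      exact hl (Finset.mem_map_of_mem Nat.castEmbedding (Finset.mem_Icc.2 (by omega)))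
  rw [bilinearOp, tsum_eq_sum (s := K.map Nat.castEmbedding)
    (fun k hk => by simp only [hk0 k hk, tsum_zero]), Finset.sum_map]
  rw [Finset.sum_congr rfl fun k hk => by
    rw [Nat.castEmbedding_apply, tsum_eq_sum (hl0 k hk), Finset.sum_map], Finset.sum_comm, lacSum,
    Finset.mul_sum]
  refine Finset.sum_congr rfl fun l hl => ?_
  rw [Finset.mem_Icc] at hl
  have := congrArg (fun f : 𝓢(ℝ, ℂ) => f x) (sum_convS_packet (L := L) hl.1 (by omega))
  simp only [sum_apply, smul_apply, smul_eq_mul, modS_apply, mulS_apply] at this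
  rw [Finset.sum_congr rfl fun k hk => by rw [Nat.castEmbedding_apply, hval k hk], this]
  push_cast
  ring

/-! ### The lower bound and the failure of all estimates. -/

lemma le_sum_quadCoeff_sq (N : ℕ) :
    (N : ℝ) / 4096 ≤ ∑ l ∈ Finset.Icc 1 N, quadCoeff (2 ^ (N + 2)) l ^ 2 := by
  have h : ∀ l ∈ Finset.Icc 1 N, (1 / 4096 : ℝ) ≤ quadCoeff (2 ^ (N + 2)) l ^ 2 := by
    intro l hl
    rw [Finset.mem_Icc] at hl
    have := one_div_le_quadCoeff (L := N + 2) (l := l) (by omega)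
    calc (1 / 4096 : ℝ) = (1 / 64) ^ 2 := by norm_num
      _ ≤ _ := by gcongr
  have := Finset.card_nsmul_le_sum _ _ _ h
  rw [Nat.card_Icc, Nat.add_sub_cancel, nsmul_eq_mul] at this
  linarith

/-- The bilinear operator is large in every `L^p` on the test functions. -/
lemma le_eLpNorm_bilinearOp_testFunction {N : ℕ} (hN : 1 ≤ N) {p : ℝ≥0∞} (hp : p ≠ 0) :
    ENNReal.ofReal (windowBound ^ 2 * √(N / 8192)) * (1 / 8) ^ (1 / p.toReal) ≤
      eLpNorm (bilinearOp scaleFamily phaseFamily (testFunction (2 ^ (N + 2)))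
        (conjS (testFunction (2 ^ (N + 2))))) p volume := by
  set c := quadCoeff (2 ^ (N + 2))
  have hA := le_sum_quadCoeff_sq N
  have hA0 : 0 < ∑ l ∈ Finset.Icc 1 N, c l ^ 2 :=
    lt_of_lt_of_le (by positivity) hA
  have hE8 := one_eighth_le_measure_lacSum (Finset.Icc 1 N) c (quadCoeff_nonneg _) hA0
  set A := ∑ l ∈ Finset.Icc 1 N, c l ^ 2
  set E := Set.Ioc (0 : ℝ) 1 ∩ {x | A / 2 ≤ ‖lacSum (Finset.Icc 1 N) c x‖ ^ 2}
  have hE : MeasurableSet E := measurableSet_Ioc.inter (measurableSet_le measurable_const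
    (by fun_prop : Continuous fun x => ‖lacSum (Finset.Icc 1 N) c x‖ ^ 2).measurable)
  have hvol : (1 / 8 : ℝ≥0∞) ≤ volume E := by
    calc (1 / 8 : ℝ≥0∞) = ENNReal.ofReal (1 / 8) := by
          rw [ENNReal.ofReal_div_of_pos (by norm_num)]; simp
      _ ≤ ENNReal.ofReal (volume.real E) := ENNReal.ofReal_le_ofReal hE8
      _ ≤ _ := ENNReal.ofReal_toReal_le
  have ha : 0 ≤ windowBound ^ 2 * √(N / 8192) := by positivity
  have h0 : volume E ≠ 0 := fun h => by
    rw [h] at hvol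
    simp at hvol
  calc _ ≤ ‖windowBound ^ 2 * √(N / 8192)‖ₑ * volume E ^ (1 / p.toReal) := by
        rw [Real.enorm_of_nonneg ha]
        gcongr
    -- This covers p = ∞ as well: there 1 / p.toReal is 0, and E has positive measure.
    _ = eLpNorm (E.indicator fun _ => windowBound ^ 2 * √(N / 8192)) p volume :=
        (eLpNorm_indicator_const' hE h0 hp).symm
    _ ≤ _ := by
        refine eLpNorm_mono fun x => ?_
        by_cases hx : x ∈ E
        · rw [Set.indicator_of_mem hx, Real.norm_of_nonneg ha,
            bilinearOp_testFunction (by omega), norm_mul, norm_pow, Nat.add_sub_cancel]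
          gcongr
          · exact windowBound_pos.le
          · exact windowBound_le hx.1
          · refine Real.sqrt_le_iff.2 ⟨norm_nonneg _, le_trans ?_ hx.2⟩
            linarith
        · rw [Set.indicator_of_notMem hx, norm_zero]
          exact norm_nonneg _

lemma exists_bound_of_satisfiesLpEstimate {p₁ p₂ : ℝ≥0∞}
    (hp : (p₁⁻¹ + p₂⁻¹)⁻¹ ≠ 0)
    (h : SatisfiesLpEstimate (bilinearOp scaleFamily phaseFamily) p₁ p₂) :
    ∃ D : ℝ≥0∞, D ≠ ∞ ∧ ∀ N : ℕ, 1 ≤ N →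
      ENNReal.ofReal (windowBound ^ 2 * √(N / 8192)) *
        (1 / 8) ^ (1 / ((p₁⁻¹ + p₂⁻¹)⁻¹).toReal) ≤ D := by
  obtain ⟨C, hC⟩ := h
  have hfin : ∀ p : ℝ≥0∞, eLpNorm window p (volume : Measure ℝ) ≠ ⊤ := fun p =>
    (window.eLpNorm_lt_top p volume).ne
  refine ⟨C * eLpNorm window p₁ volume * eLpNorm window p₂ volume,
    ENNReal.mul_ne_top (ENNReal.mul_ne_top ENNReal.coe_ne_top (hfin p₁)) (hfin p₂), ?_⟩
  intro N hN
  have hle := le_eLpNorm_bilinearOp_testFunction hN hp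
  obtain ⟨n, hn⟩ : ∃ n : ℕ, n = 2 ^ (N + 2) := ⟨_, rfl⟩
  have hpos : 0 < n := hn ▸ Nat.two_pow_pos _
  rw [← hn] at hle
  refine hle.trans ((hC (testFunction n) (conjS (testFunction n))).trans ?_)
  refine mul_le_mul' (mul_le_mul_right ?_ _) ?_
  · exact eLpNorm_mono fun x => norm_testFunction_le hpos x
  · refine eLpNorm_mono fun x => ?_
    rw [conjS_apply, RCLike.norm_conj]
    exact norm_testFunction_le hpos x

/-- An estimate would bound √N times a positive constant independent of N. The exponents enter
through p ≠ 0. -/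
lemma not_satisfiesLpEstimate {p₁ p₂ : ℝ≥0∞} (h₁ : 1 ≤ p₁) (h₂ : 1 ≤ p₂) :
    ¬ SatisfiesLpEstimate (bilinearOp scaleFamily phaseFamily) p₁ p₂ := by
  intro h
  have hp : (p₁⁻¹ + p₂⁻¹)⁻¹ ≠ 0 := by
    rw [ENNReal.inv_ne_zero, ENNReal.add_ne_top, ENNReal.inv_ne_top, ENNReal.inv_ne_top]
    exact ⟨(zero_lt_one.trans_le h₁).ne', (zero_lt_one.trans_le h₂).ne'⟩
  obtain ⟨D, hD, hle⟩ := exists_bound_of_satisfiesLpEstimate hp h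
  generalize hr : (1 / 8 : ℝ≥0∞) ^ (1 / ((p₁⁻¹ + p₂⁻¹)⁻¹).toReal) = r at hle
  have hr0 : r ≠ 0 := by
    rw [← hr]
    exact (ENNReal.rpow_pos (by simp) (by simp)).ne'
  have hrt : r ≠ ∞ := by
    rw [← hr]
    exact ENNReal.rpow_ne_top_of_nonneg (by positivity) (by simp)
  have hDr : D / r ≠ ∞ := ENNReal.div_ne_top hD hr0
  obtain ⟨N, hN⟩ := exists_nat_gt (((D / r).toReal / windowBound ^ 2) ^ 2 * 8192)
  have hN1 : 1 ≤ N := by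
    rw [Nat.one_le_iff_ne_zero]
    rintro rfl
    exact absurd hN (not_lt.2 (by rw [Nat.cast_zero]; positivity))
  have hle2 := hle N hN1
  have hκ : 0 < windowBound ^ 2 := pow_pos windowBound_pos 2
  rw [← ENNReal.le_div_iff_mul_le (.inl hr0) (.inl hrt), ENNReal.ofReal_le_iff_le_toReal hDr,
    ← le_div_iff₀' hκ, Real.sqrt_le_iff, div_le_iff₀ (by norm_num)] at hle2
  exact absurd hN (not_lt.2 hle2.2)

end

theorem proposition8 :
    ∃ (η : ℤ → 𝓢(ℝ, ℂ)) (θ : ℤ → ℤ → 𝓢(ℝ, ℂ)),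
      (∃ A : ℕ → ℝ, ∀ k : ℤ, FourierAdapted A k (η k)) ∧
      (∃ A : ℕ → ℝ, ∀ k l : ℤ, FourierAdapted A l (θ k l)) ∧
      (∀ (f₁ f₂ : 𝓢(ℝ, ℂ)) (x : ℝ),
        Summable fun q : ℤ × ℤ => bilinearTerm η θ f₁ f₂ q.1 q.2 x) ∧
      ∀ p₁ p₂ : ℝ≥0∞, 1 ≤ p₁ → 1 ≤ p₂ → ¬ SatisfiesLpEstimate (bilinearOp η θ) p₁ p₂ :=
  ⟨scaleFamily, phaseFamily, ⟨bandConst, fourierAdapted_scaleFamily⟩,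
    ⟨bandConst, fourierAdapted_phaseFamily⟩, summable_bilinearTerm,
    fun _ _ h₁ h₂ => not_satisfiesLpEstimate h₁ h₂⟩
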